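/- Let $X$ be a non-empty compact metric space, $T : X \to X$ a continuous map and $g : X \to \mathbb{R}$ a continuous function; write $S_n g = \sum_{i=0}^{n-1} g\circ T^i$. A continuous partition of unity is a finite family $\Phi = (\varphi_j)_{j}$ of continuous functions $\varphi_j : X \to [0,1]$ with $\sum_j \varphi_j \equiv 1$. For $n \geq 1$ let $\Phi_0^{n-1}$ be the family, indexed by words $(j_0,\dots,j_{n-1})$, of the products $\prod_{i=0}^{n-1} \varphi_{j_i}\circ T^i$. For a continuous partition of unity $\Phi$ and a $T$-invariant Borel probability measure $\mu$ put $$\widetilde P_{\rm top}(T,g,\Phi) = \lim_{n\to\infty}\frac1n \log \sum_{\varphi\in\Phi_0^{n-1}} \sup_X \big(\varphi\, e^{S_n g}\big),\qquad \widetilde P_{\rm top}(T,g) = \sup_\Phi \widetilde P_{\rm top}(T,g,\Phi),$$ $$\widetilde h_\mu(T,\Phi) = \lim_{n\to\infty} \frac1n \sum_{\varphi\in\Phi_0^{n-1}} \Big(-\mu(\varphi)\log\mu(\varphi) + \mu(\varphi\log\varphi)\Big),\qquad \widetilde h_\mu(T) = \sup_\Phi \widetilde h_\mu(T,\Phi),$$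 $$\widetilde P_\mu(T,g) = \sup_\Phi \Big(\widetilde h_\mu(T,\Phi) + \int_X g\,d\mu\Big),$$ where $\mu(f) = \int_X f\,d\mu$, $0\log 0 = 0$, and the suprema are over all continuous partitions of unity, with values in $(-\infty,+\infty]$. Let $P_{\rm top}(T,g)$ be the classical topological pressure, $$P_{\rm top}(T,g) = \lim_{\varepsilon\to0}\limsup_{n\to\infty}\frac1n\log\sup\Big\{\sum_{x\in E} e^{S_n g(x)} : E \subset X \text{ is } (n,\varepsilon)\text{-separated}\Big\},$$ where a finite set $E$ is $(n,\varepsilon)$-separated if $\max_{0\le i<n} d(T^i x,T^i y) > \varepsilon$ for all $x\neq y$ in $E$. Let $P_\mu(T,g) = h_\mu(T) + \int_X g\,d\mu$ be the classical metric pressure, $h_\mu(T)$ being the Kolmogorov–Sinai entropy, defined as the supremum over finite measurable partitions. Then both limits above exist for every $\Phi$ (and every $\mu$), and $$\widetilde P_{\rm top}(T,g) = P_{\rm top}(T,g).$$ Furthermore, for every $T$-invariant Borel probability measure $\mu$, $$\widetilde P_\mu(T,g) = \widetilde h_\mu(T) + \int_X g\,d\mu = P_\mu(T,g).$$ -/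

import Mathlib

open Set Filter Topology MeasureTheory

noncomputable section

namespace PartitionPressure

variable {X : Type*}

/-! ### Joins along the orbit -/

/-- The `n`-fold join `Φ ∨ TΦ ∨ ⋯ ∨ T^{n-1}Φ` of a finite family of functions
`Φ = (φ_j)_{j < k}`, where `TΦ = (φ_j ∘ T)_{j < k}`: the family of all products
`x ↦ φ_{w 0}(x) φ_{w 1}(T x) ⋯ φ_{w (n-1)}(T^{n-1} x)`, indexed by the words `w` of length `n`.
It is an indexed family: equal products coming from different words are not identified,
so that the join of a partition of unity again sums to `1`. -/
def joinFun {k : ℕ} (T : X → X) (Φ : Fin k → X → ℝ) (n : ℕ) (w : Fin n → Fin k) (x : X) : ℝ :=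
  ∏ i : Fin n, Φ (w i) (T^[i] x)

/-- The `n`-fold join `A ∨ T⁻¹A ∨ ⋯ ∨ T^{-(n-1)}A` of a finite family of sets `A = (A_j)_{j < k}`,
indexed by the words of length `n`. -/
def joinSet {k : ℕ} (T : X → X) (A : Fin k → Set X) (n : ℕ) (w : Fin n → Fin k) : Set X :=
  ⋂ i : Fin n, T^[i] ⁻¹' A (w i)

/-- The join of a finite partition of unity sums to `1`. -/
theorem sum_joinFun {k : ℕ} (T : X → X) (Φ : Fin k → X → ℝ) (h : ∀ x, ∑ j, Φ j x = 1)
    (n : ℕ) (x : X) : ∑ w : Fin n → Fin k, joinFun T Φ n w x = 1 := by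
  unfold joinFun
  rw [← Fintype.prod_sum (fun (i : Fin n) (j : Fin k) => Φ j (T^[i] x))]
  simp [h]

/-! ### Entropy and pressure through continuous partitions of unity -/

section Metric

variable [TopologicalSpace X] [MeasurableSpace X]

/-- Static entropy `∑_φ (-μ(φ) log μ(φ) + μ(φ log φ))` of a finite family of functions,
with `0 log 0 = 0`. -/
def staticEntropyPU {ι : Type*} [Fintype ι] (μ : Measure X) (Φ : ι → X → ℝ) : ℝ :=
  ∑ w, (-(∫ x, Φ w x ∂μ) * Real.log (∫ x, Φ w x ∂μ) + ∫ x, Φ w x * Real.log (Φ w x) ∂μ)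

/-- The averages `(1/n) H̃_μ(Φ_0^{n-1})`. -/
def avgEntropyPU {k : ℕ} (T : X → X) (μ : Measure X) (Φ : PartitionOfUnity (Fin k) X) (n : ℕ) : ℝ :=
  (1 / (n : ℝ)) * staticEntropyPU μ (joinFun T (fun j => Φ j) n)

/-- Local entropy `h̃_μ(T, Φ)`, the limit of `(1/n) H̃_μ(Φ_0^{n-1})`. It is written as a `limsup`
in the extended reals. -/
def localEntropyPU {k : ℕ} (T : X → X) (μ : Measure X) (Φ : PartitionOfUnity (Fin k) X) : EReal :=
  limsup (fun n : ℕ => ((avgEntropyPU T μ Φ n : ℝ) : EReal)) atTop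

/-- `h̃_μ(T)`: supremum of the local entropies over all finite continuous partitions of unity. -/
def entropyPU (T : X → X) (μ : Measure X) : EReal :=
  ⨆ (k : ℕ) (Φ : PartitionOfUnity (Fin k) X), localEntropyPU T μ Φ

/-- `P̃_μ(T, g)`: supremum over all finite continuous partitions of unity `Φ` of the local
metric pressures `h̃_μ(T, Φ) + ∫ g dμ`. -/
def metricPressurePU (T : X → X) (g : X → ℝ) (μ : Measure X) : EReal :=
  ⨆ (k : ℕ) (Φ : PartitionOfUnity (Fin k) X), (localEntropyPU T μ Φ + ((∫ x, g x ∂μ : ℝ) : EReal))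

end Metric

section Top

variable [TopologicalSpace X]

/-- Static topological pressure `∑_{φ ∈ Φ_0^{n-1}} sup (φ · e^{S_n g})`, where
`S_n g = ∑_{i < n} g ∘ T^i`. -/
def staticPressurePU {k : ℕ} (T : X → X) (g : X → ℝ) (Φ : PartitionOfUnity (Fin k) X) (n : ℕ) : ℝ :=
  ∑ w : Fin n → Fin k, ⨆ x : X, joinFun T (fun j => Φ j) n w x * Real.exp (birkhoffSum T g n x)

/-- The averages `(1/n) log P̃(T, g, Φ, n)`. -/
def avgPressurePU {k : ℕ} (T : X → X) (g : X → ℝ) (Φ : PartitionOfUnity (Fin k) X) (n : ℕ) : ℝ :=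
  (1 / (n : ℝ)) * Real.log (staticPressurePU T g Φ n)

/-- Local topological pressure `P̃_top(T, g, Φ)`, the limit of `(1/n) log P̃(T, g, Φ, n)`.
It is written as a `limsup` in the extended reals. -/
def localPressurePU {k : ℕ} (T : X → X) (g : X → ℝ) (Φ : PartitionOfUnity (Fin k) X) : EReal :=
  limsup (fun n : ℕ => ((avgPressurePU T g Φ n : ℝ) : EReal)) atTop

/-- `P̃_top(T, g)`: supremum of the local pressures over all finite continuous partitions
of unity. -/
def topPressurePU (T : X → X) (g : X → ℝ) : EReal :=
  ⨆ (k : ℕ) (Φ : PartitionOfUnity (Fin k) X), localPressurePU T g Φ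

end Top

/-! ### Classical metric entropy and pressure -/

section Classical

variable [MeasurableSpace X]

/-- `A` is a finite measurable partition of `X` (empty atoms are allowed). -/
structure IsMeasurablePartition {k : ℕ} (A : Fin k → Set X) : Prop where
  measurableSet : ∀ j, MeasurableSet (A j)
  pairwise_disjoint : Pairwise (fun i j => Disjoint (A i) (A j))
  iUnion_eq : ⋃ j, A j = univ

/-- Shannon entropy `-∑ μ(A) log μ(A)` of a finite family of sets, with `0 log 0 = 0`. -/
def shannonEntropy {ι : Type*} [Fintype ι] (μ : Measure X) (A : ι → Set X) : ℝ :=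
  ∑ w, (-(μ.real (A w)) * Real.log (μ.real (A w)))

/-- Classical entropy `h_μ(T, A) = lim (1/n) H_μ(A ∨ T⁻¹A ∨ ⋯ ∨ T^{-(n-1)}A)`. -/
def partitionEntropy {k : ℕ} (T : X → X) (μ : Measure X) (A : Fin k → Set X) : EReal :=
  limsup (fun n : ℕ =>
    (((1 / (n : ℝ)) * shannonEntropy μ (joinSet T A n) : ℝ) : EReal)) atTop

/-- Classical (Kolmogorov–Sinai) metric entropy `h_μ(T)`: supremum over all finite measurable
partitions. -/
def metricEntropy (T : X → X) (μ : Measure X) : EReal :=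
  ⨆ (k : ℕ) (A : Fin k → Set X) (_ : IsMeasurablePartition A), partitionEntropy T μ A

/-- Classical metric pressure `P_μ(T, g) = h_μ(T) + ∫ g dμ`. -/
def metricPressure (T : X → X) (g : X → ℝ) (μ : Measure X) : EReal :=
  metricEntropy T μ + ((∫ x, g x ∂μ : ℝ) : EReal)

end Classical

/-! ### Classical topological pressure -/

section ClassicalTop

variable [MetricSpace X]

/-- `E` is `(n, ε)`-separated: distinct points of `E` are at distance more than `ε` in the metric
`d_n(x, y) = max_{0 ≤ i < n} d(T^i x, T^i y)`. -/
def IsSeparatedSet (T : X → X) (n : ℕ) (ε : ℝ) (E : Finset X) : Prop :=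
  ∀ x ∈ E, ∀ y ∈ E, x ≠ y → ∃ i < n, ε < dist (T^[i] x) (T^[i] y)

/-- `P_n(T, g, ε) = sup { ∑_{x ∈ E} e^{S_n g(x)} | E is (n, ε)-separated }`. -/
def separatedSum (T : X → X) (g : X → ℝ) (n : ℕ) (ε : ℝ) : ℝ :=
  sSup {s : ℝ | ∃ E : Finset X, IsSeparatedSet T n ε E ∧
    s = ∑ x ∈ E, Real.exp (birkhoffSum T g n x)}

/-- Classical topological pressure
`P_top(T, g) = lim_{ε → 0} limsup_n (1/n) log P_n(T, g, ε)`; the inner quantity does not decrease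
when `ε` decreases, so the limit is the supremum over `ε > 0`. -/
def topPressure (T : X → X) (g : X → ℝ) : EReal :=
  ⨆ (ε : ℝ) (_ : 0 < ε),
    limsup (fun n : ℕ => (((1 / (n : ℝ)) * Real.log (separatedSum T g n ε) : ℝ) : EReal)) atTop

/-- On a compact space the supremum in `separatedSum` is that of a bounded set. -/
theorem bddAbove_separatedSum [CompactSpace X] {T : X → X} (hT : Continuous T) {g : X → ℝ}
    (hg : Continuous g) (n : ℕ) {ε : ℝ} (hε : 0 < ε) :
    BddAbove {s : ℝ | ∃ E : Finset X, IsSeparatedSet T n ε E ∧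
      s = ∑ x ∈ E, Real.exp (birkhoffSum T g n x)} := by
  classical
  have hS : Continuous (fun x => Real.exp (birkhoffSum T g n x)) := by
    unfold birkhoffSum
    exact Real.continuous_exp.comp
      (continuous_finsetSum _ fun i _ => hg.comp (hT.iterate i))
  obtain ⟨M, hM⟩ := (isCompact_range hS).bddAbove
  have hopen : ∀ x : X, {y | ∀ i ∈ Finset.range n, dist (T^[i] x) (T^[i] y) < ε / 2} ∈ 𝓝 x := by
    intro x
    have : ∀ i ∈ Finset.range n, ∀ᶠ y in 𝓝 x, dist (T^[i] x) (T^[i] y) < ε / 2 := by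
      intro i _
      have hc : Continuous fun y => dist (T^[i] x) (T^[i] y) :=
        continuous_const.dist (hT.iterate i)
      exact hc.continuousAt.eventually_lt_const (by simpa using half_pos hε)
    exact (Finset.eventually_all (Finset.range n)).2 this
  obtain ⟨t, -, ht⟩ := isCompact_univ.elim_nhds_subcover _ (fun x _ => hopen x)
  refine ⟨t.card * max M 0, ?_⟩
  rintro s ⟨E, hE, rfl⟩
  have hex : ∀ y : X, ∃ c ∈ t, ∀ i ∈ Finset.range n, dist (T^[i] c) (T^[i] y) < ε / 2 := by
    intro y
    simpa using ht (mem_univ y)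
  choose c hct hc using hex
  have hcard : E.card ≤ t.card := by
    refine Finset.card_le_card_of_injOn c (fun y _ => hct y) ?_
    intro x hx y hy hxy
    by_contra hne
    obtain ⟨i, hi, hlt⟩ := hE x hx y hy hne
    have h1 := hc x i (Finset.mem_range.2 hi)
    have h2 := hc y i (Finset.mem_range.2 hi)
    rw [← hxy] at h2
    have h3 := dist_triangle_left (T^[i] x) (T^[i] y) (T^[i] (c x))
    linarith
  calc ∑ x ∈ E, Real.exp (birkhoffSum T g n x) ≤ ∑ _x ∈ E, max M 0 :=
        Finset.sum_le_sum fun x _ => le_max_of_le_left (hM ⟨x, rfl⟩)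
    _ = E.card * max M 0 := by simp
    _ ≤ t.card * max M 0 := by gcongr

end ClassicalTop

end PartitionPressure

end

namespace PartitionPressure

variable {X : Type*}

/-! ### Measurable partitions of unity -/

/-! Topological part. If `Φ` and `g` vary by at most `η` at scale `ε`, a maximal `(n, ε)`-separated
set `E` is also spanning, so each supremum is bounded by a sum over `E` of perturbed values. Summing
over words factorizes along the orbit and costs only `((1 + k η) e^η)^n`. Conversely, if each
function of `Φ` lives on a set of diameter less than `ε`, a product in the join is nonzero at no
more than one point of an `(n, ε)`-separated set, so `separatedSum` is at most `staticPressurePU`.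

Metric part. Draw `x` by `μ`, then an index `w` with probability `ψ w x`: the static entropy is the
mutual information of `x` and `w`. Gibbs' inequality bounds it above by comparing the law of `w`
with any weights `q`, and below by testing against densities `r w` of integral at most `1`. In a
join the letters are independent given `x`, with laws `Φ · (T^i x)`, so bounds for one letter
tensorize to words with error linear in `n`.

For `h̃ ≤ h`, quantize the vector `Φ(x)` into a finite label `α x` that determines it up to a factor
`e^δ`; the information is then at most `n δ` plus the entropy of the `α`-itinerary. For `h ≤ h̃`,
approximate a labelling `α` by a continuous partition of unity through inner regularity; the index
then predicts the label with mean logarithmic loss at most `δ` per letter.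

The limits exist by Fekete's lemma: `log P̃` and the static entropy of joins are subadditive. -/

/-- A finite family of nonnegative measurable functions that sums to `1`. -/
structure IsMeasurablePU [MeasurableSpace X] {ι : Type*} [Fintype ι] (ψ : ι → X → ℝ) : Prop where
  measurable : ∀ w, Measurable (ψ w)
  nonneg : ∀ w x, 0 ≤ ψ w x
  sum_eq_one : ∀ x, ∑ w, ψ w x = 1

/-- Pointwise Gibbs inequality. -/
theorem mul_log_sub_mul_log_le {p q : ℝ} (hp : 0 ≤ p) (hq : 0 < q) :
    p * Real.log q - p * Real.log p ≤ q - p := by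
  rcases hp.eq_or_lt with rfl | hp
  · simpa using hq.le
  · have h := Real.log_le_sub_one_of_pos (div_pos hq hp)
    rw [Real.log_div hq.ne' hp.ne'] at h
    calc p * Real.log q - p * Real.log p = p * (Real.log q - Real.log p) := by ring
      _ ≤ p * (q / p - 1) := by gcongr
      _ = q - p := by field_simp

theorem abs_mul_log_le_one {p : ℝ} (hp : 0 ≤ p) (hp1 : p ≤ 1) : |p * Real.log p| ≤ 1 := by
  rcases hp.eq_or_lt with rfl | hp
  · simp
  · rw [mul_comm]
    exact (Real.abs_log_mul_self_lt p hp hp1).le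

/-! ### Variational bounds and subadditivity of the static entropy. -/

section Static

variable [MeasurableSpace X] {ι : Type*} [Fintype ι] {ψ : ι → X → ℝ}
  {μ : Measure X}

namespace IsMeasurablePU

theorem le_one (h : IsMeasurablePU ψ) (w : ι) (x : X) : ψ w x ≤ 1 := by
  rw [← h.sum_eq_one x]
  exact Finset.single_le_sum (f := fun w => ψ w x) (fun w _ => h.nonneg w x) (Finset.mem_univ w)

theorem norm_le_one (h : IsMeasurablePU ψ) (w : ι) (x : X) : ‖ψ w x‖ ≤ 1 := by
  rw [Real.norm_of_nonneg (h.nonneg w x)]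
  exact h.le_one w x

theorem integrable_mul (h : IsMeasurablePU ψ) (w : ι) {f : X → ℝ} (hf : Integrable f μ) :
    Integrable (fun x => ψ w x * f x) μ :=
  hf.bdd_mul (h.measurable w).aestronglyMeasurable (ae_of_all _ (h.norm_le_one w))

theorem sum_integral_mul (h : IsMeasurablePU ψ) {f : X → ℝ} (hf : Integrable f μ) :
    ∑ w, ∫ x, ψ w x * f x ∂μ = ∫ x, f x ∂μ := by
  rw [← integral_finsetSum _ fun w _ => h.integrable_mul w hf]
  simp_rw [← Finset.sum_mul, h.sum_eq_one, one_mul]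

theorem integral_nonneg (h : IsMeasurablePU ψ) (w : ι) : 0 ≤ ∫ x, ψ w x ∂μ :=
  MeasureTheory.integral_nonneg (h.nonneg w)

variable [IsProbabilityMeasure μ]

theorem integrable (h : IsMeasurablePU ψ) (w : ι) : Integrable (ψ w) μ :=
  .of_bound (h.measurable w).aestronglyMeasurable 1 (ae_of_all _ (h.norm_le_one w))

theorem integrable_mul_log (h : IsMeasurablePU ψ) (w : ι) :
    Integrable (fun x => ψ w x * Real.log (ψ w x)) μ :=
  .of_bound ((h.measurable w).mul (h.measurable w).log).aestronglyMeasurable 1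
    (ae_of_all _ fun x => abs_mul_log_le_one (h.nonneg w x) (h.le_one w x))

theorem sum_integral (h : IsMeasurablePU ψ) : ∑ w, ∫ x, ψ w x ∂μ = 1 := by
  simpa using h.sum_integral_mul (integrable_const (μ := μ) (1 : ℝ))

/-- Upper variational bound for the static entropy. -/
theorem staticEntropyPU_le (h : IsMeasurablePU ψ) {q : ι → ℝ} (hq : ∀ w, 0 < q w)
    (hq1 : ∑ w, q w ≤ 1) {F : X → ℝ} (hF0 : ∀ᵐ x ∂μ, 0 < F x)
    (hF : Integrable (fun x => Real.log (F x)) μ) (hle : ∀ w x, 0 < F x → ψ w x ≤ F x * q w) :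
    staticEntropyPU μ ψ ≤ ∫ x, Real.log (F x) ∂μ := by
  -- Gibbs replaces `-m log m` by `q - m - m log q`; the bound `ψ ≤ F q` then cancels `log q`. The
  -- terms `q - m` sum to at most `0`.
  have key : ∀ w, -(∫ x, ψ w x ∂μ) * Real.log (∫ x, ψ w x ∂μ) + ∫ x, ψ w x * Real.log (ψ w x) ∂μ
      ≤ q w - (∫ x, ψ w x ∂μ) + ∫ x, ψ w x * Real.log (F x) ∂μ := by
    intro w
    have h1 := mul_log_sub_mul_log_le (h.integral_nonneg (μ := μ) w) (hq w)
    have h2 : ∫ x, ψ w x * Real.log (ψ w x) ∂μ ≤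
        ∫ x, (ψ w x * Real.log (F x) + ψ w x * Real.log (q w)) ∂μ := by
      refine integral_mono_ae (h.integrable_mul_log w)
        ((h.integrable_mul w hF).add ((h.integrable w).mul_const _)) ?_
      filter_upwards [hF0] with x hx
      rcases (h.nonneg w x).eq_or_lt with h0 | h0
      · simp [← h0]
      · rw [← mul_add, ← Real.log_mul hx.ne' (hq w).ne']
        exact mul_le_mul_of_nonneg_left (Real.log_le_log h0 (hle w x hx)) h0.le
    rw [integral_add (h.integrable_mul w hF) ((h.integrable w).mul_const _),
      integral_mul_const] at h2
    linarith
  refine (Finset.sum_le_sum fun w _ => key w).trans ?_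
  rw [Finset.sum_add_distrib, Finset.sum_sub_distrib, h.sum_integral, h.sum_integral_mul hF]
  linarith

/-- Lower variational bound for the static entropy. -/
theorem le_staticEntropyPU (h : IsMeasurablePU ψ) {r : ι → X → ℝ}
    (hr0 : ∀ w, ∀ᵐ x ∂μ, 0 < r w x) (hr : ∀ w, Integrable (r w) μ)
    (hlog : ∀ w, Integrable (fun x => Real.log (r w x)) μ) (hr1 : ∀ w, ∫ x, r w x ∂μ ≤ 1) :
    ∑ w, ∫ x, ψ w x * Real.log (r w x) ∂μ ≤ staticEntropyPU μ ψ := by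
  refine Finset.sum_le_sum fun w _ => ?_
  set m := ∫ x, ψ w x ∂μ
  have hm0 : 0 ≤ m := h.integral_nonneg w
  have hae : ∀ᵐ x ∂μ, m = 0 → ψ w x = 0 := by
    by_cases h0 : m = 0
    · have := (integral_eq_zero_iff_of_nonneg (h.nonneg w) (h.integrable w)).1 h0
      filter_upwards [this] with x hx _ using hx
    · exact ae_of_all _ fun x hx => absurd hx h0
  have hi1 : Integrable (fun x => ψ w x * Real.log m) μ := (h.integrable w).mul_const _
  have hi2 : Integrable (fun x => ψ w x * Real.log m + ψ w x * Real.log (r w x)) μ :=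
    hi1.add (h.integrable_mul w (hlog w))
  -- Pointwise Gibbs for `ψ w x` against `m * r w x`; since `∫ r w ≤ 1`, the linear terms integrate
  -- to at most `0`. If `m = 0`, then `ψ w` vanishes almost everywhere.
  have h2 : ∫ x, (ψ w x * Real.log m + ψ w x * Real.log (r w x) -
      ψ w x * Real.log (ψ w x)) ∂μ ≤ ∫ x, (m * r w x - ψ w x) ∂μ := by
    refine integral_mono_ae (hi2.sub (h.integrable_mul_log w))
      (((hr w).const_mul m).sub (h.integrable w)) ?_
    filter_upwards [hae, hr0 w] with x hx hrx
    rcases hm0.eq_or_lt with h0 | h0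
    · simp [hx h0.symm, ← h0]
    · have := mul_log_sub_mul_log_le (h.nonneg w x) (mul_pos h0 hrx)
      rwa [Real.log_mul h0.ne' hrx.ne', mul_add] at this
  have e1 : ∫ x, (ψ w x * Real.log m + ψ w x * Real.log (r w x) -
      ψ w x * Real.log (ψ w x)) ∂μ = m * Real.log m + ∫ x, ψ w x * Real.log (r w x) ∂μ -
        ∫ x, ψ w x * Real.log (ψ w x) ∂μ := by
    rw [integral_sub hi2 (h.integrable_mul_log w),
      integral_add hi1 (h.integrable_mul w (hlog w)), integral_mul_const]
  have e2 : ∫ x, (m * r w x - ψ w x) ∂μ = m * (∫ x, r w x ∂μ) - m := by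
    rw [integral_sub ((hr w).const_mul m) (h.integrable w), integral_const_mul]
  have := mul_le_mul_of_nonneg_left (hr1 w) hm0
  rw [e1, e2] at h2
  linarith

theorem staticEntropyPU_nonneg (h : IsMeasurablePU ψ) : 0 ≤ staticEntropyPU μ ψ := by
  have := h.le_staticEntropyPU (μ := μ) (r := fun _ _ => 1) (by simp) (by simp) (by simp) (by simp)
  simpa using this

/-- The static entropy of the family of products of two partitions of unity is at most the sum
of the static entropies. -/
theorem staticEntropyPU_prod_le (h : IsMeasurablePU ψ) {κ : Type*} [Fintype κ] {χ : κ → X → ℝ}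
    (h' : IsMeasurablePU χ) :
    staticEntropyPU μ (fun (p : ι × κ) x => ψ p.1 x * χ p.2 x) ≤
      staticEntropyPU μ ψ + staticEntropyPU μ χ := by
  set m : ι → ℝ := fun u => ∫ x, ψ u x ∂μ
  set m' : κ → ℝ := fun v => ∫ x, χ v x ∂μ
  set P : ι → κ → ℝ := fun u v => ∫ x, ψ u x * χ v x ∂μ with hP
  have hi : ∀ u v, Integrable (fun x => ψ u x * χ v x) μ :=
    fun u v => h.integrable_mul u (h'.integrable v)
  have hP0 : ∀ u v, 0 ≤ P u v := fun u v =>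
    MeasureTheory.integral_nonneg fun x => mul_nonneg (h.nonneg u x) (h'.nonneg v x)
  have hPm : ∀ u v, P u v ≤ m u := fun u v => integral_mono (hi u v) (h.integrable u)
    fun x => mul_le_of_le_one_right (h.nonneg u x) (h'.le_one v x)
  have hPm' : ∀ u v, P u v ≤ m' v := fun u v => integral_mono (hi u v) (h'.integrable v)
    fun x => mul_le_of_le_one_left (h'.nonneg v x) (h.le_one u x)
  have hsum' : ∀ v, ∑ u, P u v = m' v := fun v => h.sum_integral_mul (h'.integrable v)
  have hsum : ∀ u, ∑ v, P u v = m u := fun u => by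
    simp_rw [hP, mul_comm (ψ u _)]
    exact h'.sum_integral_mul (h.integrable u)
  have hlog : ∀ u v, ∫ x, ψ u x * χ v x * Real.log (ψ u x * χ v x) ∂μ =
      ∫ x, χ v x * (ψ u x * Real.log (ψ u x)) ∂μ +
        ∫ x, ψ u x * (χ v x * Real.log (χ v x)) ∂μ := by
    intro u v
    rw [← integral_add (h'.integrable_mul v (h.integrable_mul_log u))
      (h.integrable_mul u (h'.integrable_mul_log v))]
    refine integral_congr_ae (ae_of_all _ fun x => ?_)
    by_cases h1 : ψ u x = 0
    · simp [h1]
    by_cases h2 : χ v x = 0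
    · simp [h2]
    simp only [Real.log_mul h1 h2]
    ring
  -- Comparison of the joint weights with the product weights `m u * m' v`: Shannon entropy is
  -- subadditive. The conditional terms `∫ φ log φ` add exactly (`hB`), as the two indices are
  -- independent given `x`.
  have hgibbs : ∀ u v, -(P u v) * Real.log (P u v) ≤
      m u * m' v - P u v - P u v * Real.log (m u) - P u v * Real.log (m' v) := by
    intro u v
    rcases (hP0 u v).eq_or_lt with h0 | h0
    · have := mul_nonneg (h.integral_nonneg (μ := μ) u) (h'.integral_nonneg (μ := μ) v)
      simpa [← h0] using this
    · have hu := h0.trans_le (hPm u v)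
      have hv := h0.trans_le (hPm' u v)
      have := mul_log_sub_mul_log_le h0.le (mul_pos hu hv)
      rw [Real.log_mul hu.ne' hv.ne'] at this
      linarith
  have hA : ∑ u, ∑ v, -(P u v) * Real.log (P u v) ≤
      ∑ u, -(m u) * Real.log (m u) + ∑ v, -(m' v) * Real.log (m' v) := by
    refine (Finset.sum_le_sum fun u _ => Finset.sum_le_sum fun v _ => hgibbs u v).trans ?_
    simp_rw [Finset.sum_sub_distrib]
    have e1 : ∑ u, ∑ v, m u * m' v = 1 := by
      simp_rw [← Finset.mul_sum, ← Finset.sum_mul]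
      rw [h.sum_integral, h'.sum_integral, one_mul]
    have e2 : ∑ u, ∑ v, P u v = 1 := by
      simp_rw [hsum]; exact h.sum_integral
    have e3 : ∑ u, ∑ v, P u v * Real.log (m u) = ∑ u, m u * Real.log (m u) := by
      simp_rw [← Finset.sum_mul, hsum]
    have e4 : ∑ u, ∑ v, P u v * Real.log (m' v) = ∑ v, m' v * Real.log (m' v) := by
      rw [Finset.sum_comm]
      simp_rw [← Finset.sum_mul, hsum']
    rw [e1, e2, e3, e4]
    simp_rw [neg_mul, Finset.sum_neg_distrib]
    linarith
  have hB : ∑ u, ∑ v, ∫ x, ψ u x * χ v x * Real.log (ψ u x * χ v x) ∂μ =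
      ∑ u, ∫ x, ψ u x * Real.log (ψ u x) ∂μ + ∑ v, ∫ x, χ v x * Real.log (χ v x) ∂μ := by
    simp_rw [hlog, Finset.sum_add_distrib]
    congr 1
    · exact Finset.sum_congr rfl fun u _ => h'.sum_integral_mul (h.integrable_mul_log u)
    · rw [Finset.sum_comm]
      exact Finset.sum_congr rfl fun v _ => h.sum_integral_mul (h'.integrable_mul_log v)
  unfold staticEntropyPU
  rw [Fintype.sum_prod_type]
  simp_rw [Finset.sum_add_distrib]
  linarith

end IsMeasurablePU

end Static

/-! ### Words -/

theorem joinFun_append {k : ℕ} (T : X → X) (Φ : Fin k → X → ℝ) {m n : ℕ} (u : Fin m → Fin k)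
    (v : Fin n → Fin k) (x : X) :
    joinFun T Φ (m + n) (Fin.append u v) x = joinFun T Φ m u x * joinFun T Φ n v (T^[m] x) := by
  unfold joinFun
  rw [Fin.prod_univ_add]
  simp only [Fin.append_left, Fin.append_right, Fin.val_castAdd, Fin.val_natAdd,
    ← Function.iterate_add_apply]
  simp_rw [add_comm]

/-- The mean of an additive functional of a word with independent letters. -/
theorem sum_prod_mul_sum {k n : ℕ} {p : Fin n → Fin k → ℝ} (hp : ∀ i, ∑ j, p i j = 1)
    (f : Fin n → Fin k → ℝ) :
    ∑ w : Fin n → Fin k, (∏ i, p i (w i)) * ∑ i, f i (w i) = ∑ i, ∑ j, p i j * f i j := by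
  simp_rw [Finset.mul_sum]
  rw [Finset.sum_comm]
  refine Finset.sum_congr rfl fun i _ => ?_
  -- Absorbing `f i (w i)` into the `i`-th factor lets the sum over words factorize; all other
  -- factors sum to `1`.
  have e : ∀ w : Fin n → Fin k, (∏ i', p i' (w i')) * f i (w i) =
      ∏ i', (p i' (w i') * if i' = i then f i' (w i') else 1) := by
    intro w
    rw [Finset.prod_mul_distrib, Finset.prod_ite_eq' Finset.univ i]
    simp
  simp_rw [e]
  rw [← Fintype.prod_sum (fun i' j => p i' j * if i' = i then f i' j else 1),
    Finset.prod_eq_single i]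
  · simp
  · intro b _ hb
    simp [hb, hp]
  · simp

/-- The word of length `n` that codes the orbit of `x` by the labels `α`. -/
def itinerary {k : ℕ} (T : X → X) (α : X → Fin k) (n : ℕ) (x : X) : Fin n → Fin k :=
  fun i => α (T^[i] x)

theorem joinSet_preimage {k : ℕ} (T : X → X) (α : X → Fin k) (n : ℕ) (a : Fin n → Fin k) :
    joinSet T (fun b => α ⁻¹' {b}) n a = itinerary T α n ⁻¹' {a} := by
  ext x
  simp [joinSet, itinerary, funext_iff]

section Measurable

variable [MeasurableSpace X] {μ : Measure X} {T : X → X}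

theorem measurable_itinerary (hT : Measurable T) {k : ℕ} {α : X → Fin k} (hα : Measurable α)
    (n : ℕ) : Measurable (itinerary T α n) :=
  measurable_pi_lambda _ fun i => hα.comp (hT.iterate i)

theorem IsMeasurablePU.joinFun (hT : Measurable T) {k : ℕ} {Φ : Fin k → X → ℝ}
    (h : IsMeasurablePU Φ) (n : ℕ) : IsMeasurablePU (joinFun T Φ n) where
  measurable w := Finset.measurable_prod _ fun i _ => (h.measurable (w i)).comp (hT.iterate i)
  nonneg _ _ := Finset.prod_nonneg fun _ _ => h.nonneg _ _
  sum_eq_one := sum_joinFun T Φ h.sum_eq_one n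

theorem staticEntropyPU_comp {ι : Type*} [Fintype ι] {ψ : ι → X → ℝ}
    (h : IsMeasurablePU ψ) {S : X → X} (hS : MeasurePreserving S μ μ) :
    staticEntropyPU μ (fun w x => ψ w (S x)) = staticEntropyPU μ ψ := by
  have key : ∀ f : X → ℝ, Measurable f → ∫ x, f (S x) ∂μ = ∫ x, f x ∂μ := by
    intro f hf
    rw [← integral_map hS.measurable.aemeasurable
      (hf.aestronglyMeasurable), hS.map_eq]
  unfold staticEntropyPU
  refine Finset.sum_congr rfl fun w _ => ?_
  rw [key _ (h.measurable w), key (fun x => ψ w x * Real.log (ψ w x))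
    ((h.measurable w).mul (h.measurable w).log)]

variable [IsProbabilityMeasure μ]

/-- Cutting words at position `m` turns the join into the product of the `m`-join and the `n`-join
composed with `T^m`; by invariance the latter keeps its entropy. -/
theorem staticEntropyPU_joinFun_add_le (hT : MeasurePreserving T μ μ) {k : ℕ}
    {Φ : Fin k → X → ℝ} (h : IsMeasurablePU Φ) (m n : ℕ) :
    staticEntropyPU μ (joinFun T Φ (m + n)) ≤
      staticEntropyPU μ (joinFun T Φ m) + staticEntropyPU μ (joinFun T Φ n) := by
  have hm := h.joinFun hT.measurable m
  have hn := h.joinFun hT.measurable n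
  have hn' : IsMeasurablePU (fun v x => joinFun T Φ n v (T^[m] x)) :=
    ⟨fun w => (hn.measurable w).comp (hT.measurable.iterate m), fun w x => hn.nonneg w _,
      fun x => hn.sum_eq_one _⟩
  rw [← staticEntropyPU_comp hn (hT.iterate m)]
  refine le_trans (le_of_eq ?_) (hm.staticEntropyPU_prod_le hn')
  unfold staticEntropyPU
  rw [← (Fin.appendEquiv m n).sum_comp]
  simp [Fin.appendEquiv, joinFun_append]

/-! ### Integrals of functions with finitely many values -/

/-- The null fibres are countably many. This makes division by the mass of the fibre of `x`, and its
logarithm, harmless almost everywhere. -/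
theorem ae_measureReal_preimage_pos {β : Type*} [Countable β] (a : X → β) :
    ∀ᵐ x ∂μ, 0 < μ.real (a ⁻¹' {a x}) := by
  have : ∀ᵐ x ∂μ, ∀ b, μ.real (a ⁻¹' {b}) = 0 → a x ≠ b := by
    refine ae_all_iff.2 fun b => ?_
    by_cases hb : μ.real (a ⁻¹' {b}) = 0
    · have h0 : μ (a ⁻¹' {b}) = 0 := (measureReal_eq_zero_iff).1 hb
      filter_upwards [measure_eq_zero_iff_ae_notMem.1 h0] with x hx _ using hx
    · exact ae_of_all _ fun x h => absurd h hb
  filter_upwards [this] with x hx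
  exact lt_of_le_of_ne measureReal_nonneg fun h => hx _ h.symm rfl

section FiniteValued

variable {β : Type*} [Fintype β] [MeasurableSpace β] [MeasurableSingletonClass β] {a : X → β}

theorem integrable_comp_of_finite (ha : Measurable a) (f : β → ℝ) :
    Integrable (fun x => f (a x)) μ :=
  have := Measure.isProbabilityMeasure_map (μ := μ) ha.aemeasurable
  (Integrable.of_finite (μ := μ.map a) (f := f)).comp_measurable ha

theorem integral_comp_of_finite (ha : Measurable a) (f : β → ℝ) :
    ∫ x, f (a x) ∂μ = ∑ b, μ.real (a ⁻¹' {b}) * f b := by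
  have := Measure.isProbabilityMeasure_map (μ := μ) ha.aemeasurable
  rw [← integral_map ha.aemeasurable (measurable_of_finite f).aestronglyMeasurable,
    integral_fintype Integrable.of_finite]
  refine Finset.sum_congr rfl fun b _ => ?_
  rw [map_measureReal_apply ha (measurableSet_singleton b), smul_eq_mul]

theorem sum_measureReal_preimage (ha : Measurable a) : ∑ b, μ.real (a ⁻¹' {b}) = 1 := by
  simpa using (integral_comp_of_finite (μ := μ) ha fun _ => (1 : ℝ)).symm

theorem integral_neg_log_measureReal (ha : Measurable a) :
    ∫ x, -Real.log (μ.real (a ⁻¹' {a x})) ∂μ = shannonEntropy μ (fun b => a ⁻¹' {b}) := by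
  rw [integral_comp_of_finite ha fun b => -Real.log (μ.real (a ⁻¹' {b}))]
  simp [shannonEntropy]

end FiniteValued

/-! ### Comparison of static entropies -/

/-- The upper variational bound with `q` the law of a word emitted by the kernel `c` from a random
itinerary, and `F = C^n / p(a x)`: keeping only the term `b = a x` of the mixture already gives `ψ ≤
F q`. -/
theorem staticEntropyPU_joinFun_le (hT : Measurable T) {k K : ℕ} {Φ : Fin k → X → ℝ}
    (h : IsMeasurablePU Φ) {α : X → Fin K} (hα : Measurable α) {c : Fin K → Fin k → ℝ}
    (hc : ∀ b j, 0 < c b j) (hc1 : ∀ b, ∑ j, c b j = 1) {C : ℝ} (hC : 0 < C)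
    (hle : ∀ j x, Φ j x ≤ C * c (α x) j) (n : ℕ) :
    staticEntropyPU μ (joinFun T Φ n) ≤
      n * Real.log C + shannonEntropy μ (joinSet T (fun b => α ⁻¹' {b}) n) := by
  set a := itinerary T α n
  have ha : Measurable a := measurable_itinerary hT hα n
  set p : (Fin n → Fin K) → ℝ := fun b => μ.real (a ⁻¹' {b}) with hp
  have hp0 : ∀ b, 0 ≤ p b := fun b => measureReal_nonneg
  have hp1 : ∑ b, p b = 1 := sum_measureReal_preimage ha
  have hcp : ∀ (b : Fin n → Fin K) (w : Fin n → Fin k), 0 < ∏ i, c (b i) (w i) :=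
    fun b w => Finset.prod_pos fun i _ => hc _ _
  obtain ⟨b₀, -, hb₀⟩ : ∃ b ∈ Finset.univ, 0 < p b :=
    Finset.exists_lt_of_sum_lt (f := fun _ => 0) (by simp [hp1])
  have hsum : ∑ w : Fin n → Fin k, ∑ b, p b * ∏ i, c (b i) (w i) ≤ 1 := by
    rw [Finset.sum_comm]
    simp_rw [← Finset.mul_sum]
    have : ∀ b : Fin n → Fin K, ∑ w : Fin n → Fin k, ∏ i, c (b i) (w i) = 1 := fun b => by
      rw [← Fintype.prod_sum fun i j => c (b i) j]
      simp [hc1]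
    simp [this, hp1]
  have hF : ∀ᵐ x ∂μ, 0 < C ^ n / p (a x) := by
    filter_upwards [ae_measureReal_preimage_pos (μ := μ) a] with x hx
    exact div_pos (pow_pos hC n) hx
  have key := (h.joinFun hT n).staticEntropyPU_le (μ := μ)
    (q := fun w => ∑ b, p b * ∏ i, c (b i) (w i))
    (fun w => Finset.sum_pos' (fun b _ => mul_nonneg (hp0 b) (hcp b w).le)
      ⟨b₀, Finset.mem_univ _, mul_pos hb₀ (hcp b₀ w)⟩) hsum hF
    (integrable_comp_of_finite ha fun b => Real.log (C ^ n / p b)) (fun w x hx => ?_)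
  · refine key.trans (le_of_eq ?_)
    have e : shannonEntropy μ (joinSet T (fun b => α ⁻¹' {b}) n) =
        ∫ x, -Real.log (p (a x)) ∂μ := by
      rw [integral_neg_log_measureReal ha]
      congr 1
      exact funext fun b => joinSet_preimage T α n b
    have e2 : ∫ x, Real.log (C ^ n / p (a x)) ∂μ =
        ∫ x, (n * Real.log C + -Real.log (p (a x))) ∂μ := by
      refine integral_congr_ae ?_
      filter_upwards [ae_measureReal_preimage_pos (μ := μ) a] with x hx
      rw [Real.log_div (pow_pos hC n).ne' hx.ne', Real.log_pow, sub_eq_add_neg]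
    rw [e, e2, integral_add (integrable_const _)
      (integrable_comp_of_finite ha fun b => -Real.log (p b))]
    simp
  -- Since `C ^ n / 0 = 0`, positivity of `F x` excludes null itineraries.
  · have hpx : 0 < p (a x) := (hp0 _).lt_of_ne fun h0 => by simp [← h0] at hx
    calc joinFun T Φ n w x ≤ ∏ i : Fin n, (C * c (a x i) (w i)) :=
          Finset.prod_le_prod (fun i _ => h.nonneg _ _) fun i _ => hle _ _
      _ = C ^ n / p (a x) * (p (a x) * ∏ i, c (a x i) (w i)) := by
          rw [Finset.prod_mul_distrib]
          simp only [Finset.prod_const, Finset.card_univ, Fintype.card_fin]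
          field_simp
      _ ≤ _ := by
          refine mul_le_mul_of_nonneg_left ?_ hx.le
          exact Finset.single_le_sum (f := fun b => p b * ∏ i, c (b i) (w i))
            (fun b _ => mul_nonneg (hp0 b) (hcp b w).le) (Finset.mem_univ _)

/-- The lower variational bound, where `r w x` is the likelihood of the itinerary of `x` under the
kernel `c` given the word `w`, divided by its probability `p`. The integral on the left is the mean
log-likelihood per letter, the same at each time by invariance. -/
theorem shannonEntropy_joinSet_le (hT : MeasurePreserving T μ μ) {k K : ℕ} {Φ : Fin k → X → ℝ}
    (h : IsMeasurablePU Φ) {α : X → Fin K} (hα : Measurable α) {c : Fin k → Fin K → ℝ}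
    (hc : ∀ j b, 0 < c j b) (hc1 : ∀ j, ∑ b, c j b = 1) (n : ℕ) :
    shannonEntropy μ (joinSet T (fun b => α ⁻¹' {b}) n) +
        n * ∫ x, ∑ j, Φ j x * Real.log (c j (α x)) ∂μ ≤
      staticEntropyPU μ (joinFun T Φ n) := by
  set a := itinerary T α n
  have ha : Measurable a := measurable_itinerary hT.measurable hα n
  set p : (Fin n → Fin K) → ℝ := fun b => μ.real (a ⁻¹' {b}) with hp
  have hp0 : ∀ b, 0 ≤ p b := fun b => measureReal_nonneg
  have hpos := ae_measureReal_preimage_pos (μ := μ) a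
  have hcp : ∀ (b : Fin n → Fin K) (w : Fin n → Fin k), 0 < ∏ i, c (w i) (b i) :=
    fun b w => Finset.prod_pos fun i _ => hc _ _
  have hψ := h.joinFun hT.measurable n
  have key := hψ.le_staticEntropyPU (μ := μ)
    (r := fun w x => (∏ i, c (w i) (a x i)) / p (a x))
    (fun w => by filter_upwards [hpos] with x hx using div_pos (hcp _ w) hx)
    (fun w => integrable_comp_of_finite ha fun b => (∏ i, c (w i) (b i)) / p b)
    (fun w => integrable_comp_of_finite ha fun b => Real.log ((∏ i, c (w i) (b i)) / p b))
    (fun w => by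
      rw [integral_comp_of_finite ha fun b => (∏ i, c (w i) (b i)) / p b]
      -- Itineraries of mass `0` contribute `0` on the left, hence only an inequality.
      calc ∑ b, p b * ((∏ i, c (w i) (b i)) / p b) ≤ ∑ b : Fin n → Fin K, ∏ i, c (w i) (b i) := by
            refine Finset.sum_le_sum fun b _ => ?_
            rcases (hp0 b).eq_or_lt with h0 | h0
            · simpa [← h0] using (hcp b w).le
            · rw [mul_div_cancel₀ _ h0.ne']
        _ = 1 := by
            rw [← Fintype.prod_sum fun i b => c (w i) b]
            simp [hc1])
  refine le_trans (le_of_eq ?_) key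
  have hint : ∀ w, Integrable (fun x => joinFun T Φ n w x *
      Real.log ((∏ i, c (w i) (a x i)) / p (a x))) μ := fun w =>
    hψ.integrable_mul w
      (integrable_comp_of_finite ha fun b => Real.log ((∏ i, c (w i) (b i)) / p b))
  set D : X → ℝ := fun x => ∑ j, Φ j x * Real.log (c j (α x)) with hD
  have hDi : Integrable D μ := integrable_finsetSum _ fun j _ =>
    h.integrable_mul j (integrable_comp_of_finite hα fun b => Real.log (c j b))
  have hDT : ∀ i : ℕ, Integrable (fun x => D (T^[i] x)) μ := fun i =>
    (hT.iterate i).integrable_comp_of_integrable hDi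
  have e1 : ∫ x, ∑ w, joinFun T Φ n w x * Real.log ((∏ i, c (w i) (a x i)) / p (a x)) ∂μ =
      ∫ x, (-Real.log (p (a x)) + ∑ i : Fin n, D (T^[i] x)) ∂μ := by
    refine integral_congr_ae ?_
    filter_upwards [hpos] with x hx
    have e : ∀ w : Fin n → Fin k, joinFun T Φ n w x *
        Real.log ((∏ i, c (w i) (a x i)) / p (a x)) =
        joinFun T Φ n w x * (-Real.log (p (a x))) +
          joinFun T Φ n w x * ∑ i, Real.log (c (w i) (a x i)) := fun w => by
      rw [Real.log_div (hcp _ w).ne' hx.ne', Real.log_prod fun i _ => (hc _ _).ne']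
      ring
    simp_rw [e, Finset.sum_add_distrib]
    rw [← Finset.sum_mul, hψ.sum_eq_one, one_mul]
    congr 1
    exact sum_prod_mul_sum (p := fun i j => Φ j (T^[i] x)) (fun i => h.sum_eq_one _)
      (fun i j => Real.log (c j (a x i)))
  have e2 : ∀ i : ℕ, ∫ x, D (T^[i] x) ∂μ = ∫ x, D x ∂μ := fun i => by
    have hS := hT.iterate i
    rw [← integral_map hS.measurable.aemeasurable
      (by rw [hS.map_eq]; exact hDi.aestronglyMeasurable), hS.map_eq]
  rw [← integral_finsetSum _ fun w _ => hint w, e1,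
    integral_add (integrable_comp_of_finite ha fun b => -Real.log (p b))
      (integrable_finsetSum _ fun (i : Fin n) _ => hDT i),
    integral_finsetSum _ fun (i : Fin n) _ => hDT i, integral_neg_log_measureReal ha]
  simp only [e2, Finset.sum_const, Finset.card_univ, Fintype.card_fin, nsmul_eq_mul]
  congr 2
  exact funext fun b => joinSet_preimage T α n b

end Measurable

/-! ### Limits in the extended reals -/

theorem tendsto_limsup_of_subadditive {u : ℕ → ℝ} (hu : Subadditive u) {M : ℝ}
    (hM : ∀ n : ℕ, -(n * M) ≤ u n) :
    Tendsto (fun n : ℕ => ((1 / (n : ℝ) * u n : ℝ) : EReal)) atTop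
      (𝓝 (limsup (fun n : ℕ => ((1 / (n : ℝ) * u n : ℝ) : EReal)) atTop)) := by
  have hb : BddBelow (range fun n => u n / n) := by
    -- The `0` covers `n = 0`, where `u 0 / 0 = 0`.
    refine ⟨min 0 (-M), ?_⟩
    rintro _ ⟨n, rfl⟩
    rcases n.eq_zero_or_pos with rfl | hn
    · simp
    · have hn' : (0 : ℝ) < n := by exact_mod_cast hn
      refine (min_le_right _ _).trans ((le_div_iff₀ hn').2 ?_)
      linarith [hM n]
  have h : Tendsto (fun n : ℕ => ((1 / (n : ℝ) * u n : ℝ) : EReal)) atTop (𝓝 (hu.lim : EReal)) := by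
    simp_rw [one_div_mul_eq_div]
    exact EReal.tendsto_coe.2 (hu.tendsto_lim hb)
  rwa [h.limsup_eq]

theorem limsup_coe_le_add {u v : ℕ → ℝ} {c : ℝ} (h : ∀ n, 1 ≤ n → u n ≤ v n + c) :
    limsup (fun n => (u n : EReal)) atTop ≤ limsup (fun n => (v n : EReal)) atTop + c := by
  have hc : limsup (fun _ : ℕ => (c : EReal)) atTop = c := limsup_const _
  calc limsup (fun n => (u n : EReal)) atTop
      ≤ limsup ((fun n => (v n : EReal)) + fun _ => (c : EReal)) atTop := by
        refine limsup_le_limsup ?_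
        filter_upwards [eventually_ge_atTop 1] with n hn
        simpa only [Pi.add_apply, ← EReal.coe_add] using EReal.coe_le_coe_iff.2 (h n hn)
    _ ≤ _ := by
        refine (EReal.limsup_add_le (Or.inr ?_) (Or.inr ?_)).trans_eq (by rw [hc])
        · rw [hc]; exact EReal.coe_ne_top _
        · rw [hc]; exact EReal.coe_ne_bot _

theorem le_of_forall_pos_le_add_coe {a b : EReal} (h : ∀ δ : ℝ, 0 < δ → a ≤ b + δ) : a ≤ b := by
  refine EReal.le_of_forall_lt_iff_le.1 fun z hz => ?_
  induction b with
  | bot =>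
    have := h 1 one_pos
    rw [EReal.bot_add] at this
    exact this.trans bot_le
  | top => simp at hz
  | coe r =>
    have hz' : r < z := by exact_mod_cast hz
    refine (h (z - r) (sub_pos.2 hz')).trans_eq ?_
    rw [← EReal.coe_add]
    congr 1
    ring

/-! ### Topological pressure -/

section Top

variable [TopologicalSpace X] {T : X → X} {g : X → ℝ} {k : ℕ} (Φ : PartitionOfUnity (Fin k) X)

theorem sum_partitionOfUnity (x : X) : ∑ j, Φ j x = 1 := by
  rw [← finsum_eq_sum_of_fintype]
  exact Φ.sum_eq_one (mem_univ x)

theorem joinFun_nonneg (n : ℕ) (w : Fin n → Fin k) (x : X) : 0 ≤ joinFun T (fun j => Φ j) n w x :=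
  Finset.prod_nonneg fun _ _ => Φ.nonneg _ _

theorem continuous_joinFun_mul_exp (hT : Continuous T) (hg : Continuous g) (n : ℕ)
    (w : Fin n → Fin k) :
    Continuous fun x => joinFun T (fun j => Φ j) n w x * Real.exp (birkhoffSum T g n x) := by
  refine Continuous.mul ?_ (Real.continuous_exp.comp ?_)
  · exact continuous_finsetProd _ fun i _ => (Φ (w i)).continuous.comp (hT.iterate i)
  · exact continuous_finsetSum _ fun i _ => hg.comp (hT.iterate i)

theorem iSup_joinFun_mul_exp_nonneg (n : ℕ) (w : Fin n → Fin k) :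
    0 ≤ ⨆ x, joinFun T (fun j => Φ j) n w x * Real.exp (birkhoffSum T g n x) :=
  Real.iSup_nonneg fun x => mul_nonneg (joinFun_nonneg Φ n w x) (Real.exp_nonneg _)

variable [CompactSpace X]

theorem joinFun_mul_exp_le_iSup (hT : Continuous T) (hg : Continuous g) (n : ℕ)
    (w : Fin n → Fin k) (x : X) :
    joinFun T (fun j => Φ j) n w x * Real.exp (birkhoffSum T g n x) ≤
      ⨆ x, joinFun T (fun j => Φ j) n w x * Real.exp (birkhoffSum T g n x) :=
  le_ciSup (isCompact_range (continuous_joinFun_mul_exp Φ hT hg n w)).bddAbove x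

/-- The join sums to `1` at `x`, so it splits `e^{S_n g(x)}` into terms below the suprema. This
gives positivity and the linear lower bound needed for Fekete's lemma. -/
theorem exp_birkhoffSum_le_staticPressurePU (hT : Continuous T) (hg : Continuous g) (n : ℕ)
    (x : X) : Real.exp (birkhoffSum T g n x) ≤ staticPressurePU T g Φ n := by
  rw [← one_mul (Real.exp _), ← sum_joinFun T (fun j => Φ j) (sum_partitionOfUnity Φ) n x,
    Finset.sum_mul]
  exact Finset.sum_le_sum fun w _ => joinFun_mul_exp_le_iSup Φ hT hg n w x

theorem staticPressurePU_pos [Nonempty X] (hT : Continuous T) (hg : Continuous g) (n : ℕ) :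
    0 < staticPressurePU T g Φ n :=
  (Real.exp_pos _).trans_le
    (exp_birkhoffSum_le_staticPressurePU Φ hT hg n (Classical.arbitrary X))

theorem staticPressurePU_add_le [Nonempty X] (hT : Continuous T) (hg : Continuous g) (m n : ℕ) :
    staticPressurePU T g Φ (m + n) ≤ staticPressurePU T g Φ m * staticPressurePU T g Φ n := by
  unfold staticPressurePU
  rw [← (Fin.appendEquiv m n).sum_comp, Fintype.sum_prod_type, Finset.sum_mul_sum]
  refine Finset.sum_le_sum fun u _ => Finset.sum_le_sum fun v _ => ciSup_le fun x => ?_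
  simp only [Fin.appendEquiv, Equiv.coe_fn_mk, joinFun_append, birkhoffSum_add, Real.exp_add]
  rw [mul_mul_mul_comm]
  exact mul_le_mul (joinFun_mul_exp_le_iSup Φ hT hg m u x)
    (joinFun_mul_exp_le_iSup Φ hT hg n v (T^[m] x))
    (mul_nonneg (joinFun_nonneg Φ n v _) (Real.exp_nonneg _))
    (iSup_joinFun_mul_exp_nonneg Φ m u)

theorem tendsto_avgPressurePU [Nonempty X] (hT : Continuous T) (hg : Continuous g) :
    Tendsto (fun n : ℕ => ((avgPressurePU T g Φ n : ℝ) : EReal)) atTop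
      (𝓝 (localPressurePU T g Φ)) := by
  obtain ⟨M, hM⟩ := (isCompact_range (f := fun x => -g x) hg.neg).bddAbove
  refine tendsto_limsup_of_subadditive (u := fun n => Real.log (staticPressurePU T g Φ n))
    (M := M) (fun m n => ?_) fun n => ?_
  · rw [← Real.log_mul (staticPressurePU_pos Φ hT hg m).ne' (staticPressurePU_pos Φ hT hg n).ne']
    exact Real.log_le_log (staticPressurePU_pos Φ hT hg _) (staticPressurePU_add_le Φ hT hg m n)
  · obtain ⟨x⟩ := ‹Nonempty X›
    rw [Real.le_log_iff_exp_le (staticPressurePU_pos Φ hT hg _)]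
    refine le_trans (Real.exp_le_exp.2 ?_) (exp_birkhoffSum_le_staticPressurePU Φ hT hg n x)
    have : ∑ _i ∈ Finset.range n, -M ≤ birkhoffSum T g n x :=
      Finset.sum_le_sum fun i _ => neg_le.1 (hM ⟨T^[i] x, rfl⟩)
    simpa using this

end Top

/-! ### Partitions of unity against separated sets. -/

section Metric

variable [MetricSpace X] [CompactSpace X] {T : X → X} {g : X → ℝ}

/-- In a separated set of maximal cardinality, a point not `ε`-shadowed could be added. -/
theorem exists_isSeparatedSet_forall_dist_le (hT : Continuous T) (n : ℕ) {ε : ℝ} (hε : 0 < ε) :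
    ∃ E : Finset X, IsSeparatedSet T n ε E ∧
      ∀ x, ∃ y ∈ E, ∀ i < n, dist (T^[i] x) (T^[i] y) ≤ ε := by
  classical
  -- For the potential `0` the separated sums are cardinalities.
  obtain ⟨B, hB⟩ := bddAbove_separatedSum hT (continuous_const (y := (0 : ℝ))) n hε
  set S : Set ℕ := {m | ∃ E : Finset X, IsSeparatedSet T n ε E ∧ E.card = m} with hS
  have hbdd : BddAbove S := by
    refine ⟨⌊B⌋₊, ?_⟩
    rintro _ ⟨E, hE, rfl⟩
    exact Nat.le_floor (hB ⟨E, hE, by simp [birkhoffSum]⟩)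
  have hne : S.Nonempty := ⟨0, ∅, by simp [IsSeparatedSet], rfl⟩
  obtain ⟨E, hE, hcard⟩ := Nat.sSup_mem hne hbdd
  refine ⟨E, hE, fun x => ?_⟩
  by_contra! hx
  have hxE : x ∉ E := fun h => by
    obtain ⟨i, -, hi⟩ := hx x h
    rw [dist_self] at hi
    exact hε.not_gt hi
  have hE' : IsSeparatedSet T n ε (insert x E) := by
    intro y hy z hz hyz
    rcases Finset.mem_insert.1 hy with hy' | hy' <;>
      rcases Finset.mem_insert.1 hz with hz' | hz'
    · exact absurd (hy'.trans hz'.symm) hyz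
    · exact hy' ▸ hx z hz'
    · obtain ⟨i, hi, h⟩ := hx y hy'
      exact ⟨i, hi, by rwa [hz', dist_comm]⟩
    · exact hE y hy' z hz' hyz
  have := le_csSup hbdd ⟨_, hE', rfl⟩
  rw [← hcard, Finset.card_insert_of_notMem hxE] at this
  omega

theorem sum_le_separatedSum (hT : Continuous T) (hg : Continuous g) {n : ℕ} {ε : ℝ} (hε : 0 < ε)
    {E : Finset X} (hE : IsSeparatedSet T n ε E) :
    ∑ x ∈ E, Real.exp (birkhoffSum T g n x) ≤ separatedSum T g n ε :=
  le_csSup (bddAbove_separatedSum hT hg n hε) ⟨E, hE, rfl⟩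

theorem separatedSum_pos [Nonempty X] (hT : Continuous T) (hg : Continuous g) (n : ℕ) {ε : ℝ}
    (hε : 0 < ε) : 0 < separatedSum T g n ε := by
  obtain ⟨x⟩ := ‹Nonempty X›
  have := sum_le_separatedSum hT hg (n := n) hε (E := {x}) (by simp [IsSeparatedSet])
  rw [Finset.sum_singleton] at this
  exact (Real.exp_pos _).trans_le this

theorem staticPressurePU_le_mul_separatedSum [Nonempty X] (hT : Continuous T) (hg : Continuous g)
    {k : ℕ} (Φ : PartitionOfUnity (Fin k) X) {η ε : ℝ} (hη : 0 < η) (hε : 0 < ε)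
    (hΦε : ∀ x y, dist x y ≤ ε → ∀ j, Φ j x ≤ Φ j y + η)
    (hgε : ∀ x y, dist x y ≤ ε → g x ≤ g y + η) (n : ℕ) :
    staticPressurePU T g Φ n ≤
      ((1 + k * η) * Real.exp η) ^ n * separatedSum T g n ε := by
  obtain ⟨E, hE, hspan⟩ := exists_isSeparatedSet_forall_dist_le hT n hε
  set G : X → (Fin n → Fin k) → ℝ := fun y w =>
    (∏ i : Fin n, (Φ (w i) (T^[i] y) + η)) * Real.exp (birkhoffSum T g n y + n * η) with hG
  have hG0 : ∀ y w, 0 ≤ G y w := fun y w => mul_nonneg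
    (Finset.prod_nonneg fun i _ => add_nonneg (Φ.nonneg _ _) hη.le) (Real.exp_nonneg _)
  have hsup : ∀ w, ⨆ x, joinFun T (fun j => Φ j) n w x * Real.exp (birkhoffSum T g n x) ≤
      ∑ y ∈ E, G y w := by
    intro w
    refine ciSup_le fun x => ?_
    obtain ⟨y, hy, hxy⟩ := hspan x
    refine le_trans ?_ (Finset.single_le_sum (f := fun y => G y w) (fun y _ => hG0 y w) hy)
    refine mul_le_mul ?_ (Real.exp_le_exp.2 ?_) (Real.exp_nonneg _)
      (Finset.prod_nonneg fun i _ => add_nonneg (Φ.nonneg _ _) hη.le)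
    · exact Finset.prod_le_prod (fun i _ => Φ.nonneg _ _) fun i _ => hΦε _ _ (hxy i i.2) _
    · have : birkhoffSum T g n x ≤ ∑ i ∈ Finset.range n, (g (T^[i] y) + η) :=
        Finset.sum_le_sum fun i hi => hgε _ _ (hxy i (Finset.mem_range.1 hi))
      simpa [Finset.sum_add_distrib, birkhoffSum] using this
  calc staticPressurePU T g Φ n ≤ ∑ w, ∑ y ∈ E, G y w := Finset.sum_le_sum fun w _ => hsup w
    _ = ∑ y ∈ E, ((1 + k * η) * Real.exp η) ^ n * Real.exp (birkhoffSum T g n y) := by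
        rw [Finset.sum_comm]
        refine Finset.sum_congr rfl fun y _ => ?_
        -- At each time the perturbed values sum to `1 + k * η`.
        rw [← Finset.sum_mul, ← Fintype.prod_sum fun (i : Fin n) j => Φ j (T^[i] y) + η]
        simp only [Finset.sum_add_distrib, sum_partitionOfUnity, Finset.sum_const, Finset.card_univ,
          Fintype.card_fin, nsmul_eq_mul, Finset.prod_const]
        rw [Real.exp_add, Real.exp_nat_mul, mul_pow]
        ring
    _ ≤ _ := by
        rw [← Finset.mul_sum]
        exact mul_le_mul_of_nonneg_left (sum_le_separatedSum hT hg hε hE) (by positivity)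

theorem exists_modulus (hg : Continuous g) {k : ℕ} (Φ : PartitionOfUnity (Fin k) X) {η : ℝ}
    (hη : 0 < η) : ∃ ε > 0, (∀ x y, dist x y ≤ ε → ∀ j, Φ j x ≤ Φ j y + η) ∧
      ∀ x y, dist x y ≤ ε → g x ≤ g y + η := by
  have hc : Continuous fun x => ((fun j => Φ j x : Fin k → ℝ), g x) :=
    (continuous_pi fun j => (Φ j).continuous).prodMk hg
  obtain ⟨ε, hε, h⟩ := Metric.uniformContinuous_iff.1
    (CompactSpace.uniformContinuous_of_continuous hc) η hη
  have h' : ∀ x y, dist x y ≤ ε / 2 → (∀ j, dist (Φ j x) (Φ j y) < η) ∧ dist (g x) (g y) < η := by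
    intro x y hxy
    have := h (hxy.trans_lt (half_lt_self hε))
    rwa [Prod.dist_eq, max_lt_iff, dist_pi_lt_iff hη] at this
  refine ⟨ε / 2, half_pos hε, fun x y hxy j => ?_, fun x y hxy => ?_⟩
  · have := (abs_lt.1 ((h' x y hxy).1 j)).2
    linarith
  · have := (abs_lt.1 (h' x y hxy).2).2
    linarith

theorem topPressurePU_le_topPressure [Nonempty X] (hT : Continuous T) (hg : Continuous g) :
    topPressurePU T g ≤ topPressure T g := by
  refine iSup₂_le fun k Φ => le_of_forall_pos_le_add_coe fun δ hδ => ?_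
  -- Chosen so that `log (1 + k η) + η ≤ (k + 1) η = δ`.
  set η : ℝ := δ / (k + 1) with hη_def
  have hη : 0 < η := by positivity
  obtain ⟨ε, hε, hΦε, hgε⟩ := exists_modulus hg Φ hη
  have hδη : k * η + η = δ := by rw [hη_def]; field_simp
  have h1 : localPressurePU T g Φ ≤ limsup (fun n : ℕ =>
      (((1 / (n : ℝ)) * Real.log (separatedSum T g n ε) : ℝ) : EReal)) atTop + δ := by
    refine limsup_coe_le_add fun n hn => ?_
    have hn' : (0 : ℝ) < n := by exact_mod_cast hn
    have hlog : Real.log (staticPressurePU T g Φ n) ≤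
        n * (Real.log (1 + k * η) + η) + Real.log (separatedSum T g n ε) := by
      refine (Real.log_le_log (staticPressurePU_pos Φ hT hg n)
        (staticPressurePU_le_mul_separatedSum hT hg Φ hη hε hΦε hgε n)).trans_eq ?_
      rw [Real.log_mul (by positivity) (separatedSum_pos hT hg n hε).ne', Real.log_pow,
        Real.log_mul (by positivity) (by positivity), Real.log_exp]
    have hl := Real.log_le_sub_one_of_pos (show (0 : ℝ) < 1 + k * η by positivity)
    have hle : Real.log (staticPressurePU T g Φ n) ≤
        n * δ + Real.log (separatedSum T g n ε) :=
      hlog.trans (by gcongr; linarith)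
    calc avgPressurePU T g Φ n ≤ 1 / (n : ℝ) * (n * δ + Real.log (separatedSum T g n ε)) :=
          mul_le_mul_of_nonneg_left hle (by positivity)
      _ = _ := by field_simp; ring
  refine h1.trans ?_
  gcongr
  exact le_iSup₂ (f := fun (ε : ℝ) (_ : 0 < ε) => limsup (fun n : ℕ =>
    (((1 / (n : ℝ)) * Real.log (separatedSum T g n ε) : ℝ) : EReal)) atTop) ε hε

theorem exists_partitionOfUnity_dist_lt {ε : ℝ} (hε : 0 < ε) :
    ∃ (k : ℕ) (Φ : PartitionOfUnity (Fin k) X),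
      ∀ j x y, Φ j x ≠ 0 → Φ j y ≠ 0 → dist x y < ε := by
  obtain ⟨t, -, htf, ht⟩ := finite_cover_balls_of_compact (isCompact_univ (X := X)) (half_pos hε)
  lift t to Finset X using htf
  obtain ⟨Φ, hΦ⟩ := PartitionOfUnity.exists_isSubordinate isClosed_univ
    (fun j : Fin t.card => Metric.ball (t.equivFin.symm j : X) (ε / 2))
    (fun _ => Metric.isOpen_ball) fun x hx => by
      obtain ⟨c, hc, hxc⟩ := mem_iUnion₂.1 (ht hx)
      exact mem_iUnion.2 ⟨t.equivFin ⟨c, hc⟩, by simpa using hxc⟩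
  refine ⟨t.card, Φ, fun j x y hx hy => ?_⟩
  have h1 := Metric.mem_ball.1 (hΦ j (subset_tsupport _ hx))
  have h2 := Metric.mem_ball'.1 (hΦ j (subset_tsupport _ hy))
  linarith [dist_triangle x (t.equivFin.symm j : X) y]

/-- Two points where the same product is nonzero stay `ε`-close up to time `n`, so each word charges
at most one point of a separated set. -/
theorem separatedSum_le_staticPressurePU (hT : Continuous T) (hg : Continuous g) {ε : ℝ}
    {k : ℕ} {Φ : PartitionOfUnity (Fin k) X}
    (hΦ : ∀ j x y, Φ j x ≠ 0 → Φ j y ≠ 0 → dist x y < ε) (n : ℕ) :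
    separatedSum T g n ε ≤ staticPressurePU T g Φ n := by
  refine csSup_le ⟨_, ∅, by simp [IsSeparatedSet], rfl⟩ ?_
  rintro _ ⟨E, hE, rfl⟩
  calc ∑ x ∈ E, Real.exp (birkhoffSum T g n x)
      = ∑ w, ∑ x ∈ E, joinFun T (fun j => Φ j) n w x * Real.exp (birkhoffSum T g n x) := by
        rw [Finset.sum_comm]
        simp_rw [← Finset.sum_mul, sum_joinFun T (fun j => Φ j) (sum_partitionOfUnity Φ), one_mul]
    _ ≤ _ := Finset.sum_le_sum fun w _ => ?_
  by_cases h : ∃ x ∈ E, joinFun T (fun j => Φ j) n w x ≠ 0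
  · obtain ⟨x, hxE, hx⟩ := h
    rw [Finset.sum_eq_single_of_mem x hxE]
    · exact joinFun_mul_exp_le_iSup Φ hT hg n w x
    · intro y hyE hyx
      by_contra hy
      obtain ⟨i, hi, hd⟩ := hE x hxE y hyE hyx.symm
      have h1 := Finset.prod_ne_zero_iff.1 hx ⟨i, hi⟩ (Finset.mem_univ _)
      have h2 := Finset.prod_ne_zero_iff.1 (left_ne_zero_of_mul hy) ⟨i, hi⟩ (Finset.mem_univ _)
      exact hd.not_gt (hΦ _ _ _ h1 h2)
  · push Not at h
    rw [Finset.sum_eq_zero fun x hx => by rw [h x hx, zero_mul]]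
    exact iSup_joinFun_mul_exp_nonneg Φ n w

theorem topPressure_le_topPressurePU [Nonempty X] (hT : Continuous T) (hg : Continuous g) :
    topPressure T g ≤ topPressurePU T g := by
  refine iSup₂_le fun ε hε => ?_
  obtain ⟨k, Φ, hΦ⟩ := exists_partitionOfUnity_dist_lt (X := X) hε
  refine le_trans (limsup_le_limsup (Eventually.of_forall fun n => ?_))
    (le_iSup₂ (f := fun (k : ℕ) (Φ : PartitionOfUnity (Fin k) X) => localPressurePU T g Φ) k Φ)
  rw [EReal.coe_le_coe_iff]
  exact mul_le_mul_of_nonneg_left (Real.log_le_log (separatedSum_pos hT hg n hε)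
    (separatedSum_le_staticPressurePU hT hg hΦ n)) (by positivity)

end Metric

/-! ### Metric entropy -/

theorem metricPressurePU_eq_entropyPU_add [TopologicalSpace X] [MeasurableSpace X]
    (T : X → X) (g : X → ℝ) (μ : Measure X) :
    metricPressurePU T g μ = entropyPU T μ + ((∫ x, g x ∂μ : ℝ) : EReal) := by
  set I : ℝ := ∫ x, g x ∂μ
  have hiff : ∀ a b : EReal, a ≤ b - (I : EReal) ↔ a + I ≤ b := fun a b =>
    EReal.le_sub_iff_add_le (Or.inl (EReal.coe_ne_bot I)) (Or.inl (EReal.coe_ne_top I))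
  refine le_antisymm (iSup₂_le fun k Φ => ?_) ?_
  · gcongr
    exact le_iSup₂_of_le (f := fun (k : ℕ) (Φ : PartitionOfUnity (Fin k) X) =>
      localEntropyPU T μ Φ) k Φ le_rfl
  · refine (hiff _ _).1 (iSup₂_le fun k Φ => (hiff _ _).2 ?_)
    exact le_iSup₂_of_le (f := fun (k : ℕ) (Φ : PartitionOfUnity (Fin k) X) =>
      localEntropyPU T μ Φ + (I : EReal)) k Φ le_rfl

/-! ### Labellings and quantization of a partition of unity. -/

section Labelling

variable [MeasurableSpace X] {k : ℕ}

theorem isMeasurablePartition_preimage {α : X → Fin k} (hα : Measurable α) :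
    IsMeasurablePartition (fun b => α ⁻¹' {b}) where
  measurableSet b := hα (measurableSet_singleton b)
  pairwise_disjoint _ _ h := Disjoint.preimage α (disjoint_singleton.2 h)
  iUnion_eq := by ext; simp

theorem exists_labelling {A : Fin k → Set X} (hA : IsMeasurablePartition A) :
    ∃ α : X → Fin k, Measurable α ∧ A = fun b => α ⁻¹' {b} := by
  have h : ∀ x, ∃ j, x ∈ A j := fun x => mem_iUnion.1 (hA.iUnion_eq ▸ mem_univ x)
  choose α hα using h
  have e : A = fun b => α ⁻¹' {b} := by
    ext b x
    refine ⟨fun hx => ?_, fun hx => ?_⟩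
    · by_contra hne
      exact disjoint_left.1 (hA.pairwise_disjoint hne) (hα x) hx
    · exact (show α x = b from hx) ▸ hα x
  refine ⟨α, measurable_to_countable' fun b => ?_, e⟩
  have := hA.measurableSet b
  rwa [e] at this

/-- A measurable labelling, with a stochastic kernel from labels to indices that controls `Φ` up to
a factor `e^δ`. -/
theorem exists_labelling_le_mul_exp [Nonempty X] {Φ : Fin k → X → ℝ} (h : IsMeasurablePU Φ)
    {δ : ℝ} (hδ : 0 < δ) :
    ∃ (K : ℕ) (α : X → Fin K) (c : Fin K → Fin k → ℝ), Measurable α ∧ (∀ b j, 0 < c b j) ∧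
      (∀ b, ∑ j, c b j = 1) ∧ ∀ j x, Φ j x ≤ Real.exp δ * c (α x) j := by
  -- Then `N + k ≤ N (1 + δ) ≤ N e^δ`. The labels record the floors of `N * Φ j x`, and `c` is
  -- proportional to floor plus one: this is positive, dominates `N * Φ j x`, and has total at most
  -- `N + k`.
  obtain ⟨N, hN⟩ := exists_nat_gt (k / δ)
  have hN0 : (0 : ℝ) < N := lt_of_le_of_lt (by positivity) hN
  have : Nonempty (Fin k) := by
    by_contra hne
    rw [not_nonempty_iff] at hne
    simpa using h.sum_eq_one (Classical.arbitrary X)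
  have hk : (0 : ℝ) < k := by exact_mod_cast Fin.pos_iff_nonempty.2 this
  let e := Fintype.equivFin (Fin k → Fin (N + 1))
  let β : X → Fin k → Fin (N + 1) := fun x j => Fin.ofNat (N + 1) ⌊(N : ℝ) * Φ j x⌋₊
  have hβ : Measurable β := measurable_pi_lambda _ fun j =>
    (measurable_from_nat (f := Fin.ofNat (N + 1))).comp
      (Nat.measurable_floor.comp ((h.measurable j).const_mul _))
  have hval : ∀ x j, ((β x j : ℕ) : ℝ) = ⌊(N : ℝ) * Φ j x⌋₊ := by
    intro x j
    have : ⌊(N : ℝ) * Φ j x⌋₊ ≤ N :=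
      Nat.floor_le_of_le (mul_le_of_le_one_right hN0.le (h.le_one j x))
    simp only [β, Fin.val_ofNat]
    rw [Nat.mod_eq_of_lt (by omega)]
  let s : (Fin k → Fin (N + 1)) → ℝ := fun b => ∑ j, (((b j : ℕ) : ℝ) + 1)
  have hs : ∀ b, 0 < s b := fun b => Finset.sum_pos (fun j _ => by positivity) Finset.univ_nonempty
  refine ⟨_, fun x => e (β x), fun b j => (((e.symm b j : ℕ) : ℝ) + 1) / s (e.symm b),
    (measurable_of_finite e).comp hβ, fun b j => div_pos (by positivity) (hs _), fun b => ?_,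
    fun j x => ?_⟩
  · rw [← Finset.sum_div, div_self (hs _).ne']
  · simp only [Equiv.symm_apply_apply, hval]
    have hsx : s (β x) ≤ N + k := by
      simp only [s, Finset.sum_add_distrib, hval]
      refine add_le_add ?_ (by simp)
      calc ∑ j, ((⌊(N : ℝ) * Φ j x⌋₊ : ℕ) : ℝ) ≤ ∑ j, (N : ℝ) * Φ j x :=
            Finset.sum_le_sum fun j _ => Nat.floor_le (mul_nonneg hN0.le (h.nonneg j x))
        _ = N := by rw [← Finset.mul_sum, h.sum_eq_one, mul_one]
    have hexp : (N + k : ℝ) ≤ N * Real.exp δ := by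
      have h1 := Real.add_one_le_exp δ
      have h2 : (k : ℝ) ≤ N * δ := ((div_lt_iff₀ hδ).1 hN).le
      nlinarith
    have hfl := (Nat.lt_floor_add_one ((N : ℝ) * Φ j x)).le
    rw [← mul_div_assoc, le_div_iff₀ (hs _)]
    calc Φ j x * s (β x) ≤ Φ j x * (N * Real.exp δ) :=
          mul_le_mul_of_nonneg_left (hsx.trans hexp) (h.nonneg j x)
      _ = Real.exp δ * (N * Φ j x) := by ring
      _ ≤ _ := mul_le_mul_of_nonneg_left hfl (Real.exp_nonneg δ)

end Labelling

/-! ### Equality of the two metric entropies. -/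

section Entropy

variable [MetricSpace X] [MeasurableSpace X] [BorelSpace X] {T : X → X} {k : ℕ}

theorem isMeasurablePU_partitionOfUnity (Φ : PartitionOfUnity (Fin k) X) :
    IsMeasurablePU (fun j => (Φ j : X → ℝ)) :=
  ⟨fun j => (Φ j).continuous.measurable, fun j x => Φ.nonneg j x, sum_partitionOfUnity Φ⟩

variable {μ : Measure X} [IsProbabilityMeasure μ]

theorem tendsto_avgEntropyPU (hT : MeasurePreserving T μ μ) (Φ : PartitionOfUnity (Fin k) X) :
    Tendsto (fun n : ℕ => ((avgEntropyPU T μ Φ n : ℝ) : EReal)) atTop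
      (𝓝 (localEntropyPU T μ Φ)) :=
  have h := isMeasurablePU_partitionOfUnity Φ
  tendsto_limsup_of_subadditive (M := 0) (fun m n => staticEntropyPU_joinFun_add_le hT h m n)
    fun n => by simpa using (h.joinFun hT.measurable n).staticEntropyPU_nonneg

theorem entropyPU_le_metricEntropy [Nonempty X] (hT : Measurable T) :
    entropyPU T μ ≤ metricEntropy T μ := by
  refine iSup₂_le fun k Φ => le_of_forall_pos_le_add_coe fun δ hδ => ?_
  have h := isMeasurablePU_partitionOfUnity Φ
  obtain ⟨K, α, c, hα, hc, hc1, hle⟩ := exists_labelling_le_mul_exp h hδ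
  have h1 : localEntropyPU T μ Φ ≤ partitionEntropy T μ (fun b => α ⁻¹' {b}) + δ := by
    refine limsup_coe_le_add fun n hn => ?_
    have hn' : (0 : ℝ) < n := by exact_mod_cast hn
    have := staticEntropyPU_joinFun_le (μ := μ) hT h hα hc hc1 (Real.exp_pos δ) hle n
    rw [Real.log_exp] at this
    calc avgEntropyPU T μ Φ n ≤ 1 / (n : ℝ) * (n * δ + _) :=
          mul_le_mul_of_nonneg_left this (by positivity)
      _ = _ := by field_simp; ring
  refine h1.trans ?_
  gcongr
  exact le_iSup_of_le K (le_iSup₂_of_le _ (isMeasurablePartition_preimage hα) le_rfl)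

/-- A measurable labelling is approximated by a continuous partition of unity. -/
theorem exists_partitionOfUnity_integral_le [Nonempty X] {α : X → Fin k}
    (hα : Measurable α) {ε : ℝ} (hε : 0 < ε) :
    ∃ Φ : PartitionOfUnity (Fin k) X, ∫ x, (1 - Φ (α x) x) ∂μ ≤ ε := by
  have hk : (0 : ℝ) < k := by
    exact_mod_cast Fin.pos_iff_nonempty.2 ⟨α (Classical.arbitrary X)⟩
  have hm : ∀ b, MeasurableSet (α ⁻¹' {b}) := fun b => hα (measurableSet_singleton b)
  have hK : ∀ b, ∃ F ⊆ α ⁻¹' {b}, IsClosed F ∧ μ (α ⁻¹' {b} \ F) < ENNReal.ofReal (ε / k) :=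
    fun b => (hm b).exists_isClosed_sdiff_lt (measure_ne_top _ _)
      (ENNReal.ofReal_pos.2 (div_pos hε hk)).ne'
  choose F hFα hFc hFμ using hK
  have hF : ∀ {b x}, x ∈ F b → α x = b := fun {b x} hx => hFα b hx
  -- The `b`-th open set avoids every `F i` with `i ≠ b`, so `Φ b = 1` on `F b`; only the small set
  -- outside the `F b` contributes to the integral.
  obtain ⟨Φ, hΦ⟩ := PartitionOfUnity.exists_isSubordinate isClosed_univ
    (fun b => (⋃ i ∈ ({b}ᶜ : Set (Fin k)), F i)ᶜ)
    (fun b => ((toFinite _).isClosed_biUnion fun i _ => hFc i).isOpen_compl) fun x _ => by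
      refine mem_iUnion.2 ⟨α x, fun hx => ?_⟩
      obtain ⟨i, hi, hxi⟩ := mem_iUnion₂.1 hx
      exact hi (hF hxi).symm
  have hone : ∀ x, x ∈ F (α x) → Φ (α x) x = 1 := by
    intro x hx
    refine (Finset.sum_eq_single_of_mem (f := fun b => Φ b x) (α x) (Finset.mem_univ _)
      fun b _ hb => ?_).symm.trans (sum_partitionOfUnity Φ x)
    by_contra h0
    exact hΦ b (subset_tsupport _ h0) (mem_iUnion₂.2 ⟨α x, hb.symm, hx⟩)
  refine ⟨Φ, ?_⟩
  set R : Set X := ⋃ b, α ⁻¹' {b} \ F b with hR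
  have hRm : MeasurableSet R := MeasurableSet.iUnion fun b => (hm b).diff (hFc b).measurableSet
  have hle : ∀ x, 1 - Φ (α x) x ≤ R.indicator (fun _ => 1) x := by
    intro x
    by_cases hx : x ∈ F (α x)
    · rw [hone x hx, sub_self]
      exact indicator_nonneg (fun _ _ => zero_le_one) x
    · have hxR : x ∈ R := mem_iUnion.2 ⟨α x, rfl, hx⟩
      rw [indicator_of_mem hxR]
      linarith [Φ.nonneg (α x) x]
  calc ∫ x, (1 - Φ (α x) x) ∂μ ≤ ∫ x, R.indicator (fun _ => (1 : ℝ)) x ∂μ :=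
        integral_mono_of_nonneg (ae_of_all _ fun x => sub_nonneg.2 (Φ.le_one _ _))
          ((integrable_const 1).indicator hRm) (ae_of_all _ hle)
    _ = μ.real R := integral_indicator_one hRm
    _ ≤ ∑ b, μ.real (α ⁻¹' {b} \ F b) := measureReal_iUnion_fintype_le _
    _ ≤ ∑ _b : Fin k, ε / k := Finset.sum_le_sum fun b _ =>
        ENNReal.toReal_le_of_le_ofReal (by positivity) (hFμ b).le
    _ = ε := by simp; field_simp

/-- The kernel is `t` times the identity plus a constant `s`. A correct index costs at most `-log t
= δ / 2`; a wrong one costs at most `-log s`, but has mean probability at most `ε`. -/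
theorem exists_partitionOfUnity_neg_le_integral [Nonempty X] {α : X → Fin k}
    (hα : Measurable α) {δ : ℝ} (hδ : 0 < δ) :
    ∃ (Φ : PartitionOfUnity (Fin k) X) (c : Fin k → Fin k → ℝ), (∀ j b, 0 < c j b) ∧
      (∀ j, ∑ b, c j b = 1) ∧ -δ ≤ ∫ x, ∑ j, Φ j x * Real.log (c j (α x)) ∂μ := by
  have hk : (0 : ℝ) < k := by
    exact_mod_cast Fin.pos_iff_nonempty.2 ⟨α (Classical.arbitrary X)⟩
  have hk1 : (1 : ℝ) ≤ k := by exact_mod_cast (Nat.cast_pos.1 hk)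
  set t : ℝ := Real.exp (-(δ / 2)) with ht
  have ht0 : 0 < t := Real.exp_pos _
  have ht1 : t < 1 := by rw [ht, Real.exp_lt_one_iff]; linarith
  -- Forced by the row sums `t + k * s = 1`.
  set s : ℝ := (1 - t) / k with hs
  have hs0 : 0 < s := div_pos (by linarith) hk
  have hs1 : s ≤ 1 := (div_le_one hk).2 (by linarith)
  have hlogs : Real.log s ≤ 0 := Real.log_nonpos hs0.le hs1
  -- Gives `ε * (-log s) ≤ δ / 2`; `s` depends only on `δ` and `k`, so `ε` can be fixed before `Φ`.
  set ε : ℝ := δ / (2 * (1 - Real.log s)) with hε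
  have hε0 : 0 < ε := div_pos hδ (by linarith)
  obtain ⟨Φ, hΦ⟩ := exists_partitionOfUnity_integral_le (μ := μ) hα hε0
  have h := isMeasurablePU_partitionOfUnity Φ
  let c : Fin k → Fin k → ℝ := fun j b => (if b = j then t else 0) + s
  have hcs : ∀ j b, s ≤ c j b := fun j b => by
    simp only [c]; split_ifs <;> linarith
  have hct : ∀ j, t ≤ c j j := fun j => by simp [c, hs0.le]
  refine ⟨Φ, c, fun j b => hs0.trans_le (hcs j b), fun j => ?_, ?_⟩
  · simp only [c, Finset.sum_add_distrib, Finset.sum_ite_eq', Finset.mem_univ, if_true,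
      Finset.sum_const, Finset.card_univ, Fintype.card_fin, nsmul_eq_mul, hs]
    field_simp
    ring
  have hpt : ∀ x, -(δ / 2) + (1 - Φ (α x) x) * Real.log s ≤
      ∑ j, Φ j x * Real.log (c j (α x)) := by
    intro x
    have hrest : ∑ j ∈ Finset.univ.erase (α x), Φ j x = 1 - Φ (α x) x := by
      rw [← sum_partitionOfUnity Φ x, ← Finset.add_sum_erase _ _ (Finset.mem_univ (α x))]
      ring
    rw [← Finset.add_sum_erase _ _ (Finset.mem_univ (α x)), ← hrest, Finset.sum_mul]
    refine add_le_add ?_ (Finset.sum_le_sum fun j _ =>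
      mul_le_mul_of_nonneg_left (Real.log_le_log hs0 (hcs _ _)) (Φ.nonneg _ _))
    have h1 : -(δ / 2) ≤ Real.log (c (α x) (α x)) := by
      rw [← Real.log_exp (-(δ / 2))]
      exact Real.log_le_log ht0 (hct _)
    have h2 := mul_le_mul_of_nonneg_left h1 (Φ.nonneg (α x) x)
    have h3 := Φ.le_one (α x) x
    nlinarith
  have hΦm : Measurable fun x => Φ (α x) x :=
    (measurable_from_prod_countable_right (f := fun p : Fin k × X => Φ p.1 p.2)
      fun j => (Φ j).continuous.measurable).comp (hα.prodMk measurable_id)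
  have hΦi : Integrable (fun x => 1 - Φ (α x) x) μ :=
    .of_bound (measurable_const.sub hΦm).aestronglyMeasurable 1 (ae_of_all _ fun x => by
      rw [Real.norm_of_nonneg (sub_nonneg.2 (Φ.le_one _ _))]
      linarith [Φ.nonneg (α x) x])
  calc -δ ≤ -(δ / 2) + ε * Real.log s := by
        have : ε * (1 - Real.log s) = δ / 2 := by
          rw [hε]
          have : 1 - Real.log s ≠ 0 := by linarith
          field_simp
        nlinarith
    _ ≤ -(δ / 2) + (∫ x, (1 - Φ (α x) x) ∂μ) * Real.log s := by
        linarith [mul_le_mul_of_nonpos_right hΦ hlogs]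
    _ = ∫ x, (-(δ / 2) + (1 - Φ (α x) x) * Real.log s) ∂μ := by
        rw [integral_add (integrable_const _) (hΦi.mul_const _), integral_mul_const]
        simp
    _ ≤ _ := integral_mono ((integrable_const _).add (hΦi.mul_const _))
        (integrable_finsetSum _ fun j _ =>
          h.integrable_mul j (integrable_comp_of_finite hα fun b => Real.log (c j b))) hpt

theorem metricEntropy_le_entropyPU [Nonempty X] (hT : MeasurePreserving T μ μ) :
    metricEntropy T μ ≤ entropyPU T μ := by
  refine iSup₂_le fun k A => iSup_le fun hA => le_of_forall_pos_le_add_coe fun δ hδ => ?_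
  obtain ⟨α, hα, rfl⟩ := exists_labelling hA
  obtain ⟨Φ, c, hc, hc1, hD⟩ := exists_partitionOfUnity_neg_le_integral (μ := μ) hα hδ
  have h1 : partitionEntropy T μ (fun b => α ⁻¹' {b}) ≤ localEntropyPU T μ Φ + δ := by
    refine limsup_coe_le_add fun n hn => ?_
    have hn' : (0 : ℝ) < n := by exact_mod_cast hn
    have h2 := shannonEntropy_joinSet_le hT (isMeasurablePU_partitionOfUnity Φ) hα hc hc1 n
    have h3 := mul_le_mul_of_nonneg_left hD hn'.le
    have h4 : shannonEntropy μ (joinSet T (fun b => α ⁻¹' {b}) n) ≤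
        staticEntropyPU μ (joinFun T (fun j => Φ j) n) + n * δ := by linarith
    calc 1 / (n : ℝ) * shannonEntropy μ (joinSet T (fun b => α ⁻¹' {b}) n)
        ≤ 1 / (n : ℝ) * (staticEntropyPU μ (joinFun T (fun j => Φ j) n) + n * δ) :=
          mul_le_mul_of_nonneg_left h4 (by positivity)
      _ = avgEntropyPU T μ Φ n + δ := by unfold avgEntropyPU; field_simp
  refine h1.trans ?_
  gcongr
  exact le_iSup₂_of_le (f := fun (k : ℕ) (Φ : PartitionOfUnity (Fin k) X) =>
    localEntropyPU T μ Φ) k Φ le_rfl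

end Entropy

end PartitionPressure

theorem mainTheorem4 {X : Type*} [MetricSpace X] [CompactSpace X] [Nonempty X]
    [MeasurableSpace X] [BorelSpace X] (T : X → X) (hT : Continuous T)
    (g : X → ℝ) (hg : Continuous g) :
    ((∀ (k : ℕ) (Φ : PartitionOfUnity (Fin k) X),
        Tendsto (fun n : ℕ => ((PartitionPressure.avgPressurePU T g Φ n : ℝ) : EReal)) atTop
          (𝓝 (PartitionPressure.localPressurePU T g Φ))) ∧
      PartitionPressure.topPressurePU T g = PartitionPressure.topPressure T g) ∧
    ∀ (μ : Measure X) [IsProbabilityMeasure μ], MeasurePreserving T μ μ →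
      (∀ (k : ℕ) (Φ : PartitionOfUnity (Fin k) X),
        Tendsto (fun n : ℕ => ((PartitionPressure.avgEntropyPU T μ Φ n : ℝ) : EReal)) atTop
          (𝓝 (PartitionPressure.localEntropyPU T μ Φ))) ∧
      PartitionPressure.metricPressurePU T g μ =
        PartitionPressure.entropyPU T μ + ((∫ x, g x ∂μ : ℝ) : EReal) ∧
      PartitionPressure.metricPressurePU T g μ = PartitionPressure.metricPressure T g μ := by
  refine ⟨⟨fun k Φ => PartitionPressure.tendsto_avgPressurePU Φ hT hg, le_antisymm
    (PartitionPressure.topPressurePU_le_topPressure hT hg)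
    (PartitionPressure.topPressure_le_topPressurePU hT hg)⟩, fun μ _ hμ =>
    ⟨fun k Φ => PartitionPressure.tendsto_avgEntropyPU hμ Φ,
      PartitionPressure.metricPressurePU_eq_entropyPU_add T g μ, ?_⟩⟩
  rw [PartitionPressure.metricPressurePU_eq_entropyPU_add, PartitionPressure.metricPressure,
    le_antisymm (PartitionPressure.entropyPU_le_metricEntropy hμ.measurable)
      (PartitionPressure.metricEntropy_le_entropyPU hμ)]
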